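/- Let $\mathbb D=\{z\in\mathbb C:|z|<1\}$ and $1<\alpha\le 2$. Let $Co(\alpha)$ be the family of functions $f:\mathbb D\to\mathbb C$ such that: (i) $f$ is analytic in $\mathbb D$ with $f(0)=0$, $f'(0)=1$ and $f(1)=\infty$, i.e. $|f(z)|\to\infty$ as $z\to1$, $z\in\mathbb D$; (ii) $f$ maps $\mathbb D$ conformally (injectively) onto a set whose complement with respect to $\mathbb C$ is convex; (iii) the opening angle of $f(\mathbb D)$ at $\infty$ is at most $\pi\alpha$. Here the opening angle of $\Omega\subset\mathbb C$ at $\infty$ is the Lebesgue measure of the set of all $\theta\in(-\pi,\pi]$ such that for every $w\in\mathbb C$ one has $w+te^{i\theta}\in\Omega$ for all sufficiently large $t$. For $0<p<\infty$ let $H^p$ be the Hardy space of all analytic functions $f$ in $\mathbb D$ with $$\sup_{0\le r<1}\frac1{2\pi}\int_0^{2\pi}|f(re^{i\theta})|^p\,d\theta<\infty .$$ Then $Co(\alpha)\subset H^p$ for every $p$ with $0<p<1/\alpha$. The range of $p$ is best possible: for every $p\ge 1/\alpha$ there is a function $f\in Co(\alpha)$ with $f\notin H^p$. -/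

import Mathlib

open Filter Topology Set MeasureTheory

/-- The opening angle at `∞` of a plane domain `Ω`: the total angle (Lebesgue measure) of the set
of directions `e^{iθ}`, `-π < θ ≤ π`, such that every ray with this direction finally stays
in `Ω`. If `Ω` is the complement of a nonempty closed convex set `K`, these are exactly the
directions outside the recession cone of `K`; so the opening angle at `∞` of (the complement of)
a sector is the angle of that sector (of its complement). -/
noncomputable def openingAngleAtInfinity (Ω : Set ℂ) : ℝ :=
  volume.real {θ : ℝ | θ ∈ Ioc (-Real.pi) Real.pi ∧
    ∀ w : ℂ, ∀ᶠ t : ℝ in atTop, w + (t : ℂ) * Complex.exp ((θ : ℂ) * Complex.I) ∈ Ω}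

/-- The family `Co(α)` of concave univalent functions. A function on the unit disk is represented
by a function on `ℂ`, whose values outside of the disk are irrelevant. -/
structure IsConcaveUnivalent (α : ℝ) (f : ℂ → ℂ) : Prop where
  analytic : DifferentiableOn ℂ f (Metric.ball 0 1)
  map_zero : f 0 = 0
  deriv_zero : deriv f 0 = 1
  /-- `f(1) = ∞` -/
  map_one : Tendsto f (𝓝[Metric.ball 0 1] 1) (Bornology.cobounded ℂ)
  /-- `f` is univalent, so that it maps the disk conformally onto its image -/
  univalent : InjOn f (Metric.ball 0 1)
  convex_compl : Convex ℝ (f '' Metric.ball 0 1)ᶜ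
  openingAngle_le : openingAngleAtInfinity (f '' Metric.ball 0 1) ≤ Real.pi * α

/-- `Co(α)` as a set of functions. -/
def Co (α : ℝ) : Set (ℂ → ℂ) := {f | IsConcaveUnivalent α f}

/-- The Hardy space `H^p`, `0 < p < ∞`, of the unit disk: the analytic functions on the disk whose
integral means `(1/2π) ∫₀^{2π} |f(r e^{iθ})|^p dθ` are bounded for `0 ≤ r < 1`. -/
def HardySpace (p : ℝ) : Set (ℂ → ℂ) :=
  {f | DifferentiableOn ℂ f (Metric.ball 0 1) ∧
    ∃ C : ℝ, ∀ r : ℝ, 0 ≤ r → r < 1 → Real.circleAverage (fun z => ‖f z‖ ^ p) 0 r ≤ C}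

/-! Let `K` be the closed convex complement of `f(𝔻)`. It is nonempty by a maximum principle
argument; fix `w₀ ∈ K` and write `f - w₀ = exp L`. If `f - w₀` takes a value in direction `θ`, the
ray from `w₀` in that direction leaves `K`. By convexity no ray in direction `θ` then meets `K` at
arbitrarily large times, so `θ` counts towards the opening angle. Since `K` is star-shaped about
`w₀`, `Im L` never takes two values differing by a nonzero multiple of `2π`, so its range is an
interval of length at most `πα` (`IsConcaveUnivalent.exists_log_sub`).

For `p < 1/α`, a rotated power `(f - w₀)^p` therefore lies in a fixed sector strictly inside the
right half-plane. There the modulus is bounded by a multiple of the real part, whose circle means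
are constant (`mem_hardySpace_of_im_log_bounded`).

Sharpness: with `h = (1 + z)/(1 - z)`, a normalization of `h^α` maps onto the complement of a
sector. Already `|h| = |h^α|^{1/α}` has circle means growing at least like `log (1/(1 - r))`, so
this one function serves every `p ≥ 1/α`. -/

/-! ### The argument of `f - w₀` and the opening angle. -/

/-- A nonvanishing holomorphic function on a disk has a holomorphic logarithm. -/
theorem DifferentiableOn.exists_exp_eq_on_ball {g : ℂ → ℂ} {c : ℂ} {r : ℝ}
    (hg : DifferentiableOn ℂ g (Metric.ball c r)) (h0 : ∀ z ∈ Metric.ball c r, g z ≠ 0) :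
    ∃ L : ℂ → ℂ, DifferentiableOn ℂ L (Metric.ball c r) ∧
      ∀ z ∈ Metric.ball c r, Complex.exp (L z) = g z := by
  rcases le_or_gt r 0 with hr | hr
  · exact ⟨0, by simp [Metric.ball_eq_empty.2 hr]⟩
  have hc : c ∈ Metric.ball c r := Metric.mem_ball_self hr
  have hd : DifferentiableOn ℂ (fun z => _root_.deriv g z / g z) (Metric.ball c r) :=
    
    (hg.deriv Metric.isOpen_ball).fun_div hg h0
  obtain ⟨L, hL⟩ := hd.isExactOn_ball.with_val_at c (Complex.log (g c))
  have hL' : ∀ z ∈ Metric.ball c r, HasDerivAt L (_root_.deriv g z / g z) z := hL.2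
  refine ⟨L, fun z hz => (hL' z hz).differentiableAt.differentiableWithinAt, fun z hz => ?_⟩
  have hder : ∀ w ∈ Metric.ball c r, HasDerivAt (fun w => g w * Complex.exp (-L w)) 0 w := by
    intro w hw
    have hgw := (hg.differentiableAt (Metric.isOpen_ball.mem_nhds hw)).hasDerivAt
    refine (hgw.mul (hL' w hw).neg.cexp).congr_deriv ?_
    field_simp [h0 w hw]
    ring
  have hconst : g z * Complex.exp (-L z) = g c * Complex.exp (-L c) :=
    Metric.isOpen_ball.is_const_of_deriv_eq_zero (convex_ball c r).isPreconnected
      (fun w hw => (hder w hw).differentiableAt.differentiableWithinAt)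
      (fun w hw => (hder w hw).deriv) hz hc
  rw [hL.1, Complex.exp_neg (Complex.log _), Complex.exp_log (h0 c hc), mul_inv_cancel₀ (h0 c hc),
    Complex.exp_neg] at hconst
  field_simp at hconst
  exact hconst.symm

/-- A real interval in which no two points differ by a multiple of `2π`, and which modulo `2π` lies
in `E ⊆ (-π, π]`, is not longer than the measure of `E`. -/
theorem sub_le_volume_of_injective_mod_two_pi {J E : Set ℝ} (hJ : J.OrdConnected)
    (hinj : ∀ x ∈ J, ∀ y ∈ J, ∀ n : ℤ, y = x + n * (2 * Real.pi) → y = x)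
    (hE : E ⊆ Ioc (-Real.pi) Real.pi)
    (hJE : ∀ x ∈ J, ∀ n : ℤ, x + n * (2 * Real.pi) ∈ Ioc (-Real.pi) Real.pi →
      x + n * (2 * Real.pi) ∈ E) {a b : ℝ} (ha : a ∈ J) (hb : b ∈ J) :
    b - a ≤ volume.real E := by
  have hpi := Real.pi_pos
  rcases le_total b a with hab | hab
  · exact (sub_nonpos.2 hab).trans measureReal_nonneg
  have hlt : b - a < 2 * Real.pi := by
    by_contra! h
    have := hinj a ha (a + 2 * Real.pi) (hJ.out ha hb ⟨by linarith, by linarith⟩) 1 (by simp)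
    linarith
  have hfin : volume E ≠ ⊤ := measure_ne_top_of_subset hE (by simp)
  obtain ⟨n, hn, -⟩ := existsUnique_add_zsmul_mem_Ioc Real.two_pi_pos a (-Real.pi)
  rw [zsmul_eq_mul] at hn
  set s : ℝ := n * (2 * Real.pi) with hs
  have hn' : a + s ≤ Real.pi := by linarith [hn.2]
  have hsub : ∀ x, a ≤ x → x ≤ b → x + s ≤ Real.pi → x + s ∈ E := fun x h1 h2 h3 =>
    hJE x (hJ.out ha hb ⟨h1, h2⟩) n ⟨by linarith [hn.1], h3⟩
  rcases le_or_gt (b + s) Real.pi with h | h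
  -- The translate of `[a, b]` starts in `(-π, π]`. Either it stays there, or the part beyond `π` is
  -- moved back by `2π`; the two pieces are disjoint because `b - a < 2π`.
  · have : Icc (a + s) (b + s) ⊆ E := fun y hy => by
      have := hsub (y - s) (by linarith [hy.1]) (by linarith [hy.2]) (by linarith [hy.2])
      rwa [sub_add_cancel] at this
    have := measureReal_mono this hfin
    rw [Real.volume_real_Icc_of_le (by linarith)] at this
    linarith
  · have h1 : Ioc (a + s) Real.pi ⊆ E := fun y hy => by
      have := hsub (y - s) (by linarith [hy.1]) (by linarith [hy.2]) (by linarith [hy.2])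
      rwa [sub_add_cancel] at this
    have h2 : Ioc (-Real.pi) (b + s - 2 * Real.pi) ⊆ E := fun y hy => by
      have h3 := hJE (y - s + 2 * Real.pi)
        (hJ.out ha hb ⟨by linarith [hy.1], by linarith [hy.2]⟩) (n - 1)
      have h4 : y - s + 2 * Real.pi + (n - 1 : ℤ) * (2 * Real.pi) = y := by
        push_cast; rw [hs]; ring
      rw [h4] at h3
      exact h3 ⟨hy.1, by linarith [hy.2]⟩
    have hdisj : Disjoint (Ioc (a + s) Real.pi) (Ioc (-Real.pi) (b + s - 2 * Real.pi)) :=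
      Set.disjoint_left.2 fun y hy hy' => by linarith [hy.1, hy'.2]
    have := measureReal_mono (union_subset h1 h2) hfin
    rw [measureReal_union hdisj measurableSet_Ioc (by simp) (by simp), Real.volume_real_Ioc_of_le hn',
      Real.volume_real_Ioc_of_le (by linarith)] at this
    linarith

/-- An injective holomorphic function on the unit disk, with continuous inverse, omits a value. -/
theorem image_unitBall_ne_univ_of_injOn {f : ℂ → ℂ} {F : ℂ → ℂ}
    (hf : DifferentiableOn ℂ f (Metric.ball 0 1)) (h0 : f 0 = 0) (h1 : deriv f 0 = 1)
    (hinj : InjOn f (Metric.ball 0 1)) (hF : ContinuousOn F (f '' Metric.ball 0 1))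
    (hFf : LeftInvOn F f (Metric.ball 0 1)) : f '' Metric.ball 0 1 ≠ univ := by
  intro huniv
  have hmem0 : (0 : ℂ) ∈ Metric.ball (0 : ℂ) 1 := Metric.mem_ball_self one_pos
  rw [huniv, continuousOn_univ] at hF
  have hg : DifferentiableOn ℂ (dslope f 0) (Metric.ball 0 1) :=
    (Complex.differentiableOn_dslope (Metric.isOpen_ball.mem_nhds hmem0)).2 hf
  have hg0 : ∀ z ∈ Metric.ball (0 : ℂ) 1, dslope f 0 z ≠ 0 := by
    intro z hz
    rcases eq_or_ne z 0 with rfl | hne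
    · simp [h1]
    · rw [dslope_of_ne _ hne, slope_def_field, h0]
      have : f z ≠ 0 := fun h => hne (hinj hz hmem0 (h.trans h0.symm))
      simp [this, hne]
  have hh : DifferentiableOn ℂ (fun z => (dslope f 0 z)⁻¹) (Metric.ball 0 1) := hg.inv hg0
  -- If `f` were onto, the preimage of `|w| ≤ 2` would be compact in the disk, so `|f| > 2` on some
  -- circle `|z| = r < 1`. The maximum principle for `z / f(z)` then gives `1 / |f'(0)| ≤ 1/2`; any
  -- radius above 1 would do in place of 2.
  have hK : IsCompact (F '' Metric.closedBall 0 2) := (isCompact_closedBall 0 2).image hF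
  have hKb : F '' Metric.closedBall 0 2 ⊆ Metric.ball 0 1 := by
    rintro _ ⟨w, -, rfl⟩
    obtain ⟨z, hz, rfl⟩ : w ∈ f '' Metric.ball 0 1 := huniv ▸ mem_univ w
    rwa [hFf hz]
  obtain ⟨r, hr0, hr1, hr⟩ : ∃ r : ℝ, 0 < r ∧ r < 1 ∧
      F '' Metric.closedBall 0 2 ⊆ Metric.ball 0 r := by
    obtain ⟨r, hr, hr'⟩ := exists_pos_lt_subset_ball one_pos hK.isClosed hKb
    exact ⟨r, hr.1, hr.2, hr'⟩
  have hsub : Metric.closedBall (0 : ℂ) r ⊆ Metric.ball 0 1 := Metric.closedBall_subset_ball hr1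
  have key : ‖(dslope f 0 0)⁻¹‖ ≤ 1 / 2 := by
    refine Complex.norm_le_of_forall_mem_frontier_norm_le (f := fun z => (dslope f 0 z)⁻¹)
      (Metric.isBounded_ball (x := 0) (r := r))
      (DifferentiableOn.diffContOnCl (hh.mono ?_)) ?_ (subset_closure (Metric.mem_ball_self hr0))
    · rw [closure_ball _ hr0.ne']; exact hsub
    · intro z hz
      rw [frontier_ball _ hr0.ne'] at hz
      have hzr : ‖z‖ = r := by simpa using hz
      have hz1 : z ∈ Metric.ball (0 : ℂ) 1 := by simpa [hzr] using hr1
      have hz0 : z ≠ 0 := by rintro rfl; simp at hzr; exact hr0.ne hzr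
      have hfz : 2 < ‖f z‖ := by
        by_contra! h
        have := hr ⟨f z, by simpa using h, hFf hz1⟩
        simp [hzr] at this
      rw [dslope_of_ne _ hz0, slope_def_field, h0, sub_zero, sub_zero, inv_div, norm_div, hzr,
        div_le_div_iff₀ (by linarith) two_pos]
      linarith
  rw [dslope_same, h1] at key
  norm_num at key

/-- The open mapping theorem; it makes the image open and the inverse of `f` continuous. -/
theorem isOpenMap_domRestrict_of_injOn {f : ℂ → ℂ} {U : Set ℂ} (hU : IsOpen U)
    (hUc : IsPreconnected U) (hUn : U.Nontrivial) (hf : DifferentiableOn ℂ f U)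
    (hinj : InjOn f U) : IsOpenMap (U.domRestrict f) := by
  rcases (hf.analyticOnNhd hU).is_constant_or_isOpen hUc with ⟨w, hw⟩ | h
  · obtain ⟨x, hx, y, hy, hxy⟩ := hUn
    exact absurd (hinj hx hy ((hw x hx).trans (hw y hy).symm)) hxy
  · intro s hs
    have : U.domRestrict f '' s = f '' (Subtype.val '' s) := by
      rw [image_image]; rfl
    rw [this]
    exact h _ (by rintro _ ⟨x, -, rfl⟩; exact x.2) (hU.isOpenMap_subtype_val s hs)

/-- If a closed convex set meets a ray at arbitrarily large times, the parallel ray from each of its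
points stays in the set. -/
theorem Convex.add_smul_mem_of_frequently {E : Type*} [NormedAddCommGroup E] [NormedSpace ℝ E]
    {K : Set E} (hK : Convex ℝ K) (hKc : IsClosed K) {w w₀ u : E} (hw₀ : w₀ ∈ K)
    (h : ∃ᶠ t : ℝ in atTop, w + t • u ∈ K) {ρ : ℝ} (hρ : 0 ≤ ρ) : w₀ + ρ • u ∈ K := by
  -- The approximating points are the convex combinations `(1 - ρ/t) w₀ + (ρ/t) (w + t u)`.
  have htend : Tendsto (fun t : ℝ => w₀ + ρ • u + (ρ / t) • (w - w₀)) atTop (𝓝 (w₀ + ρ • u)) := by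
    have h1 : Tendsto (fun t : ℝ => ρ / t) atTop (𝓝 0) := tendsto_const_nhds.div_atTop tendsto_id
    simpa using (h1.smul_const (w - w₀)).const_add (w₀ + ρ • u)
  refine hKc.mem_of_frequently_of_tendsto ?_ htend
  refine (h.and_eventually (eventually_ge_atTop (max ρ 1))).mono ?_
  rintro t ⟨ht, htρ⟩
  have ht0 : 0 < t := one_pos.trans_le ((le_max_right ρ 1).trans htρ)
  have hle : ρ / t ≤ 1 := (div_le_one ht0).2 ((le_max_left ρ 1).trans htρ)
  have hmem := hK hw₀ ht (sub_nonneg.2 hle) (div_nonneg hρ ht0.le) (by ring)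
  convert hmem using 1
  have : ρ • u = (ρ / t) • t • u := by rw [smul_smul, div_mul_cancel₀ _ ht0.ne']
  rw [this]
  module

/-- If `f - w₀ = exp L` and the complement of the image of `f` is star-shaped around `w₀`, then the
argument `Im L` is determined by its value modulo `2π`. -/
theorem im_log_injective_mod_two_pi {f F L : ℂ → ℂ} {w₀ : ℂ} {U : Set ℂ}
    (hF : ContinuousOn F (f '' U)) (hFf : LeftInvOn F f U) (hstar : StarConvex ℝ w₀ (f '' U)ᶜ)
    (hL : ContinuousOn L U) (hexp : ∀ z ∈ U, Complex.exp (L z) = f z - w₀)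
    {z₁ z₂ : ℂ} (h₁ : z₁ ∈ U) (h₂ : z₂ ∈ U) {n : ℤ}
    (hn : (L z₂).im = (L z₁).im + n * (2 * Real.pi)) : (L z₂).im = (L z₁).im := by
  set u : ℂ := Complex.exp ((L z₁).im * Complex.I) with hu
  set S : Set ℝ := {t | 0 < t ∧ w₀ + t • u ∈ f '' U} with hS
  have hdiv : ∀ z ∈ U, ∀ m : ℤ, (L z).im = (L z₁).im + m * (2 * Real.pi) →
      f z = w₀ + Real.exp (L z).re • u := by
    intro z hz m hm
    rw [← sub_eq_iff_eq_add', ← hexp z hz, Complex.real_smul, hu, Complex.ofReal_exp,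
      ← Complex.exp_add, Complex.exp_eq_exp_iff_exists_int]
    refine ⟨m, ?_⟩
    conv_lhs => rw [← Complex.re_add_im (L z), hm]
    push_cast
    ring
  have hmem : ∀ z ∈ U, ∀ m : ℤ, (L z).im = (L z₁).im + m * (2 * Real.pi) →
      Real.exp (L z).re ∈ S := fun z hz m hm =>
    ⟨Real.exp_pos _, by rw [← hdiv z hz m hm]; exact mem_image_of_mem f hz⟩
  -- Were a radius `s ≥ a` omitted, the segment from `w₀` to that point would be omitted too,
  -- including radius `a`. So `S` is an upper set of radii.
  have hSc : S.OrdConnected := by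
    refine ⟨fun a ha b hb s hs => ⟨ha.1.trans_le hs.1, ?_⟩⟩
    by_contra hcon
    have hs0 : 0 < s := ha.1.trans_le hs.1
    have := hstar hcon (a := 1 - a / s) (b := a / s)
      (sub_nonneg.2 ((div_le_one hs0).2 hs.1)) (div_nonneg ha.1.le hs0.le) (by ring)
    apply this
    convert ha.2 using 1
    have : a • u = (a / s) • s • u := by rw [smul_smul, div_mul_cancel₀ _ hs0.ne']
    rw [this]
    module
  have hFU : MapsTo F (f '' U) U := by
    rintro _ ⟨z, hz, rfl⟩
    rwa [hFf hz]
  -- Along the ray the argument changes only by multiples of `2π`; this normalized difference is a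
  -- continuous integer-valued function on the connected set `S`, hence constant.
  have hcont : ContinuousOn (fun t : ℝ => ((L (F (w₀ + t • u))).im - (L z₁).im) / (2 * Real.pi))
      S := by
    have h1 : ContinuousOn (fun t : ℝ => w₀ + t • u) S := by fun_prop
    have h2 : ContinuousOn (fun t : ℝ => L (F (w₀ + t • u))) S :=
      hL.comp (hF.comp h1 fun t ht => ht.2) fun t ht => hFU ht.2
    exact ((Complex.continuous_im.comp_continuousOn h2).sub continuousOn_const).div_const _
  have hmaps : MapsTo (fun t : ℝ => ((L (F (w₀ + t • u))).im - (L z₁).im) / (2 * Real.pi))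
      S (range ((↑) : ℤ → ℝ)) := by
    rintro t ⟨ht0, z, hz, hzt⟩
    have h1 := hexp z hz
    rw [hzt, add_sub_cancel_left, Complex.real_smul, hu, ← Real.exp_log ht0, Complex.ofReal_exp,
      ← Complex.exp_add, Complex.exp_eq_exp_iff_exists_int] at h1
    obtain ⟨m, hm⟩ := h1
    refine ⟨m, ?_⟩
    have him := congrArg Complex.im hm
    simp at him
    simp only
    rw [← hzt, hFf hz, him]
    field_simp
    ring
  have hdisc : IsDiscrete (range ((↑) : ℤ → ℝ)) :=
    Int.isClosedEmbedding_coe_real.isInducing.isDiscrete_range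
  have := hSc.isPreconnected.constant_of_mapsTo hdisc hcont hmaps
    (hmem z₁ h₁ 0 (by simp)) (hmem z₂ h₂ n hn)
  rw [← hdiv z₁ h₁ 0 (by simp), ← hdiv z₂ h₂ n hn, hFf h₁, hFf h₂] at this
  rw [sub_self, zero_div, eq_comm, div_eq_zero_iff, or_iff_left (by positivity)] at this
  linarith

/-- A concave univalent function omits a value `w₀` such that a continuous branch of the argument of
`f - w₀` takes its values in an interval that is not longer than the opening angle. -/
theorem IsConcaveUnivalent.exists_log_sub {α : ℝ} {f : ℂ → ℂ} (hf : IsConcaveUnivalent α f) :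
    ∃ (w₀ : ℂ) (L : ℂ → ℂ) (m : ℝ), DifferentiableOn ℂ L (Metric.ball 0 1) ∧
      (∀ z ∈ Metric.ball (0 : ℂ) 1, Complex.exp (L z) = f z - w₀) ∧
      ∀ z ∈ Metric.ball (0 : ℂ) 1, |(L z).im - m| ≤ Real.pi * α / 2 := by
  set D : Set ℂ := Metric.ball 0 1 with hD
  have hDc : IsPreconnected D := (convex_ball _ _).isPreconnected
  have h0D : (0 : ℂ) ∈ D := Metric.mem_ball_self one_pos
  have hop : IsOpenMap (D.domRestrict f) :=
    isOpenMap_domRestrict_of_injOn Metric.isOpen_ball hDc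
      ⟨0, h0D, 1 / 2, by simp [hD]; norm_num, by norm_num⟩ hf.analytic hf.univalent
  have hΩ : IsOpen (f '' D) := by
    have := hop.isOpen_range
    rwa [range_domRestrict] at this
  set F := Function.invFunOn f D
  have hFf : LeftInvOn F f D := hf.univalent.leftInvOn_invFunOn
  have hF : ContinuousOn F (f '' D) := hop.continuousOn_image_of_leftInvOn hFf
  obtain ⟨w₀, hw₀⟩ := (ne_univ_iff_exists_notMem _).1 <|
    image_unitBall_ne_univ_of_injOn hf.analytic hf.map_zero hf.deriv_zero hf.univalent hF hFf
  obtain ⟨L, hL, hexp⟩ := (hf.analytic.sub_const w₀).exists_exp_eq_on_ball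
    fun z hz h => hw₀ ⟨z, hz, sub_eq_zero.1 h⟩
  set J : Set ℝ := (fun z => (L z).im) '' D with hJ
  have hJc : IsPreconnected J :=
    hDc.image _ (Complex.continuous_im.comp_continuousOn hL.continuousOn)
  have hlen : ∀ a ∈ J, ∀ b ∈ J, b - a ≤ Real.pi * α := by
    intro a ha b hb
    refine le_trans (sub_le_volume_of_injective_mod_two_pi hJc.ordConnected ?_
      (fun θ hθ => hθ.1) ?_ ha hb) hf.openingAngle_le
    · rintro _ ⟨z₁, h₁, rfl⟩ _ ⟨z₂, h₂, rfl⟩ n hn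
      exact im_log_injective_mod_two_pi hF hFf (hf.convex_compl.starConvex hw₀) hL.continuousOn
        hexp h₁ h₂ hn
    · rintro _ ⟨z, hz, rfl⟩ n hn
      refine ⟨hn, fun w => ?_⟩
      by_contra hcon
      -- If a parallel ray met the complement at arbitrarily large times, the ray from `w₀` would
      -- stay in the complement, yet it passes through `f z` at distance `exp (Re L z)`.
      have hray := hf.convex_compl.add_smul_mem_of_frequently hΩ.isClosed_compl hw₀
        (w := w) (u := Complex.exp ((L z).im * Complex.I)) (ρ := Real.exp (L z).re)
        (by
          refine (not_eventually.1 hcon).mono fun t ht => ?_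
          convert ht using 2
          rw [Complex.real_smul]
          congr 2
          rw [Complex.exp_eq_exp_iff_exists_int]
          exact ⟨-n, by push_cast; ring⟩) (Real.exp_pos _).le
      apply hray
      refine ⟨z, hz, ?_⟩
      rw [← sub_eq_iff_eq_add', ← hexp z hz, Complex.real_smul, Complex.ofReal_exp,
        ← Complex.exp_add, Complex.re_add_im]
  have hJn : J.Nonempty := ⟨_, mem_image_of_mem _ h0D⟩
  obtain ⟨a, ha⟩ := hJn
  have hbb : BddBelow J := ⟨a - Real.pi * α, fun x hx => by linarith [hlen x hx a ha]⟩
  have hba : BddAbove J := ⟨a + Real.pi * α, fun x hx => by linarith [hlen a ha x hx]⟩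
  have hsub : sSup J - sInf J ≤ Real.pi * α := by
    rw [sub_le_iff_le_add]
    refine csSup_le ⟨a, ha⟩ fun b hb => ?_
    rw [← sub_le_iff_le_add']
    refine le_csInf ⟨a, ha⟩ fun c hc => ?_
    linarith [hlen c hc b hb]
  refine ⟨w₀, L, (sSup J + sInf J) / 2, hL, hexp, fun z hz => ?_⟩
  have h1 := le_csSup hba (mem_image_of_mem (fun z => (L z).im) hz)
  have h2 := csInf_le hbb (mem_image_of_mem (fun z => (L z).im) hz)
  rw [abs_le]
  constructor <;> linarith

/-! ### Hardy space membership. -/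

theorem ContinuousOn.circleIntegrable_norm_rpow {f : ℂ → ℂ} {p r : ℝ}
    (hf : ContinuousOn f (Metric.ball 0 1)) (hp : 0 ≤ p) (hr0 : 0 ≤ r) (hr1 : r < 1) :
    CircleIntegrable (fun z => ‖f z‖ ^ p) 0 r :=
  ContinuousOn.circleIntegrable hr0 <| (hf.mono <| Metric.sphere_subset_closedBall.trans
    (Metric.closedBall_subset_ball hr1)).norm.rpow_const fun _ _ => Or.inr hp

/-- If a branch of the argument of `f - w₀` takes its values in an interval of length `2δ` and
`pδ < π/2`, then `f` belongs to the Hardy space `H^p`. -/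
theorem mem_hardySpace_of_im_log_bounded {f L : ℂ → ℂ} {w₀ : ℂ} {m δ p : ℝ}
    (hf : DifferentiableOn ℂ f (Metric.ball 0 1)) (hL : DifferentiableOn ℂ L (Metric.ball 0 1))
    (hexp : ∀ z ∈ Metric.ball (0 : ℂ) 1, Complex.exp (L z) = f z - w₀)
    (hm : ∀ z ∈ Metric.ball (0 : ℂ) 1, |(L z).im - m| ≤ δ)
    (hp0 : 0 < p) (hp1 : p ≤ 1) (hpδ : p * δ < Real.pi / 2) : f ∈ HardySpace p := by
  have hδ : 0 ≤ δ := (abs_nonneg _).trans (hm 0 (Metric.mem_ball_self one_pos))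
  have hcos : 0 < Real.cos (p * δ) :=
    Real.cos_pos_of_mem_Ioo ⟨by nlinarith [Real.pi_pos], hpδ⟩
  -- A holomorphic function whose real part dominates `|f|^p`: the rotated power of `f - w₀` has
  -- argument at most `pδ` in modulus, hence the factor `1 / cos (pδ)`; the constant comes from
  -- subadditivity of `t ↦ t^p`, `p ≤ 1`.
  set k : ℂ → ℂ := fun z => Complex.exp (p * (L z - m * Complex.I)) / Real.cos (p * δ) +
    ((‖w₀‖ ^ p : ℝ) : ℂ) with hk
  have hkd : DifferentiableOn ℂ k (Metric.ball 0 1) :=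
    ((((hL.sub_const _).const_mul _).cexp).div_const _).add_const _
  have hle : ∀ z ∈ Metric.ball (0 : ℂ) 1, ‖f z‖ ^ p ≤ (k z).re := by
    intro z hz
    have h1 : ‖f z‖ ^ p ≤ ‖f z - w₀‖ ^ p + ‖w₀‖ ^ p := by
      refine (Real.rpow_le_rpow (norm_nonneg _) (?_ : ‖f z‖ ≤ ‖f z - w₀‖ + ‖w₀‖) hp0.le).trans
        (Real.rpow_add_le_add_rpow (norm_nonneg _) (norm_nonneg _) hp0.le hp1)
      simpa using norm_add_le (f z - w₀) w₀
    have h2 : ‖f z - w₀‖ ^ p = Real.exp (p * (L z).re) := by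
      rw [← hexp z hz, Complex.norm_exp, ← Real.exp_mul, mul_comm]
    have h3 : (k z).re = Real.exp (p * (L z).re) * Real.cos (p * ((L z).im - m)) /
        Real.cos (p * δ) + ‖w₀‖ ^ p := by
      simp only [hk]
      rw [Complex.add_re, Complex.ofReal_re, Complex.div_ofReal_re, Complex.exp_re]
      simp
    have h4 : Real.cos (p * δ) ≤ Real.cos (p * ((L z).im - m)) := by
      rw [← Real.cos_abs (p * ((L z).im - m)), abs_mul, abs_of_pos hp0]
      refine Real.cos_le_cos_of_nonneg_of_le_pi (by positivity) (by linarith [Real.pi_pos]) ?_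
      exact mul_le_mul_of_nonneg_left (hm z hz) hp0.le
    rw [h3]
    refine h1.trans (add_le_add_left ?_ _)
    rw [h2, le_div_iff₀ hcos]
    exact mul_le_mul_of_nonneg_left h4 (Real.exp_pos _).le
  refine ⟨hf, (k 0).re, fun r hr0 hr1 => ?_⟩
  have hsub : Metric.closedBall (0 : ℂ) |r| ⊆ Metric.ball 0 1 :=
    Metric.closedBall_subset_ball (by rwa [abs_of_nonneg hr0])
  have hkc : ContinuousOn k (Metric.sphere 0 r) :=
    hkd.continuousOn.mono (Metric.sphere_subset_closedBall.trans (by rwa [abs_of_nonneg hr0] at hsub))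
  have hmean : Real.circleAverage (fun z => (k z).re) 0 r = (k 0).re := by
    have h1 := Complex.reCLM.circleAverage_comp_comm (hkc.circleIntegrable hr0)
    have h2 : Real.circleAverage k 0 r = k 0 :=
      (hkd.mono (Metric.closure_ball_subset_closedBall.trans hsub)).diffContOnCl.circleAverage
    rw [h2] at h1
    exact h1
  rw [← hmean]
  refine Real.circleAverage_mono (hf.continuousOn.circleIntegrable_norm_rpow hp0.le hr0 hr1)
    ((Complex.continuous_re.comp_continuousOn hkc).circleIntegrable hr0) fun z hz => hle z ?_
  exact hsub (Metric.sphere_subset_closedBall hz)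

theorem Co_subset_hardySpace {α p : ℝ} (hα : 1 < α) (hp0 : 0 < p) (hp : p < 1 / α) :
    Co α ⊆ HardySpace p := by
  intro f hf
  obtain ⟨w₀, L, m, hL, hexp, hm⟩ := IsConcaveUnivalent.exists_log_sub hf
  have hα0 : 0 < α := one_pos.trans hα
  have hpα : p * α < 1 := (lt_div_iff₀ hα0).1 hp
  refine mem_hardySpace_of_im_log_bounded hf.analytic hL hexp hm hp0 (by nlinarith) ?_
  nlinarith [Real.pi_pos]

/-! ### The extremal function and its membership in `Co(α)`. -/

/-- The conformal map `(1 + z) / (1 - z)` of the unit disk onto the right half-plane. -/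
noncomputable def halfPlaneMap (z : ℂ) : ℂ := (1 + z) / (1 - z)

theorem one_sub_ne_zero_of_mem_ball {z : ℂ} (hz : z ∈ Metric.ball (0 : ℂ) 1) : 1 - z ≠ 0 := by
  rintro h
  rw [← sub_eq_zero.1 h] at hz
  simp at hz

theorem halfPlaneMap_re_pos {z : ℂ} (hz : z ∈ Metric.ball (0 : ℂ) 1) : 0 < (halfPlaneMap z).re := by
  have hn : 0 < Complex.normSq (1 - z) := Complex.normSq_pos.2 (one_sub_ne_zero_of_mem_ball hz)
  have hz1 : Complex.normSq z < 1 := by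
    rw [Complex.normSq_eq_norm_sq]
    have : ‖z‖ < 1 := by simpa using hz
    nlinarith [norm_nonneg z]
  rw [Complex.normSq_apply] at hz1
  rw [halfPlaneMap, Complex.div_re, ← add_div]
  refine div_pos ?_ hn
  simp
  nlinarith

theorem halfPlaneMap_injOn : InjOn halfPlaneMap (Metric.ball 0 1) := by
  intro z hz w hw h
  have h1 := one_sub_ne_zero_of_mem_ball hz
  have h2 := one_sub_ne_zero_of_mem_ball hw
  rw [halfPlaneMap, halfPlaneMap, div_eq_div_iff h1 h2] at h
  linear_combination h / 2

theorem exists_halfPlaneMap_eq {w : ℂ} (hw : 0 < w.re) :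
    ∃ z ∈ Metric.ball (0 : ℂ) 1, halfPlaneMap z = w := by
  have hw1 : w + 1 ≠ 0 := fun h => by
    have := congrArg Complex.re h
    simp at this
    linarith
  refine ⟨(w - 1) / (w + 1), ?_, ?_⟩
  · rw [mem_ball_zero_iff, norm_div, div_lt_one (norm_pos_iff.2 hw1),
      ← sq_lt_sq₀ (norm_nonneg _) (norm_nonneg _), ← Complex.normSq_eq_norm_sq,
      ← Complex.normSq_eq_norm_sq, Complex.normSq_apply, Complex.normSq_apply]
    simp
    nlinarith
  · rw [halfPlaneMap]
    have h2 : 1 - (w - 1) / (w + 1) = 2 / (w + 1) := by field_simp; ring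
    have h3 : 1 + (w - 1) / (w + 1) = 2 * w / (w + 1) := by field_simp; ring
    rw [h2, h3]
    field_simp

theorem hasDerivAt_halfPlaneMap {z : ℂ} (hz : 1 - z ≠ 0) :
    HasDerivAt halfPlaneMap (2 / (1 - z) ^ 2) z := by
  refine (((hasDerivAt_id z).const_add 1).div ((hasDerivAt_id z).const_sub 1) hz).congr_deriv ?_
  congr 1
  simp
  ring

/-- The open sector with vertex `0`, axis of symmetry `[0, ∞)` and half opening angle `γ`, for
`0 ≤ γ ≤ π`. -/
def openSector (γ : ℝ) : Set ℂ := {v | ‖v‖ * Real.cos γ < v.re}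

/-- As `cos γ ≤ 0`, the complement is a sublevel set of the convex function `v ↦ Re v - ‖v‖ cos γ`.
-/
theorem convex_compl_openSector {γ : ℝ} (hγ : Real.cos γ ≤ 0) : Convex ℝ (openSector γ)ᶜ := by
  intro x hx y hy a b ha hb hab
  simp only [openSector, mem_compl_iff, mem_ofPred_eq, not_lt] at hx hy ⊢
  have h1 : ‖a • x + b • y‖ ≤ a * ‖x‖ + b * ‖y‖ := by
    refine (norm_add_le _ _).trans_eq ?_
    rw [norm_smul, norm_smul, Real.norm_of_nonneg ha, Real.norm_of_nonneg hb]
  have h2 : (a • x + b • y).re = a * x.re + b * y.re := by simp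
  rw [h2]
  nlinarith [mul_le_mul_of_nonneg_left hx ha, mul_le_mul_of_nonneg_left hy hb,
    mul_le_mul_of_nonpos_right h1 hγ]

theorem abs_lt_of_cos_lt_cos {γ θ : ℝ} (hγ : 0 ≤ γ) (hθ : |θ| ≤ Real.pi)
    (h : Real.cos γ < Real.cos θ) : |θ| < γ := by
  by_contra! hcon
  have := Real.cos_le_cos_of_nonneg_of_le_pi hγ hθ hcon
  rw [Real.cos_abs] at this
  linarith

theorem cpow_mem_openSector {α : ℝ} (hα0 : 0 < α) (hα : α ≤ 2) {u : ℂ} (hu : 0 < u.re) :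
    u ^ (α : ℂ) ∈ openSector (Real.pi * α / 2) := by
  have hu0 : u ≠ 0 := by rintro rfl; simp at hu
  have harg := Complex.abs_arg_lt_pi_div_two_iff.2 (Or.inl hu)
  rw [openSector, mem_ofPred_eq, Complex.norm_cpow_real, Complex.cpow_ofReal_re]
  refine mul_lt_mul_of_pos_left ?_ (Real.rpow_pos_of_pos (norm_pos_iff.2 hu0) _)
  rw [← Real.cos_abs (u.arg * α), abs_mul, abs_of_pos hα0]
  exact Real.cos_lt_cos_of_nonneg_of_le_pi (by positivity) (by nlinarith [Real.pi_pos])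
    (by nlinarith)

/-- The principal branches compose because `|α arg u| < π`, which is where `α ≤ 2` enters. -/
theorem cpow_cpow_inv {α : ℝ} (hα0 : 0 < α) (hα : α ≤ 2) {u : ℂ} (hu : 0 < u.re) :
    (u ^ (α : ℂ)) ^ ((α : ℂ)⁻¹) = u := by
  have harg := abs_lt.1 (Complex.abs_arg_lt_pi_div_two_iff.2 (Or.inl hu))
  have him : (Complex.log u * α).im = u.arg * α := by simp [Complex.log_im]
  rw [← Complex.cpow_mul, mul_inv_cancel₀ (by exact_mod_cast hα0.ne'), Complex.cpow_one]
  · rw [him]; nlinarith [Real.pi_pos]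
  · rw [him]; nlinarith [Real.pi_pos]

theorem exists_cpow_eq_of_mem_openSector {α : ℝ} (hα : 1 ≤ α) {v : ℂ}
    (hv : v ∈ openSector (Real.pi * α / 2)) : ∃ u : ℂ, 0 < u.re ∧ u ^ (α : ℂ) = v := by
  have hα0 : 0 < α := one_pos.trans_le hα
  have hpi := Real.pi_pos
  rw [openSector, mem_ofPred_eq] at hv
  have hv0 : v ≠ 0 := by rintro rfl; simp at hv
  have hn : 0 < ‖v‖ := norm_pos_iff.2 hv0
  have harg : |v.arg| < Real.pi * α / 2 := by
    refine abs_lt_of_cos_lt_cos (by positivity) (Complex.abs_arg_le_pi v) ?_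
    rw [Complex.cos_arg hv0, lt_div_iff₀ hn]
    linarith
  have harg' : |v.arg * α⁻¹| < Real.pi / 2 := by
    rw [abs_mul, abs_of_pos (inv_pos.2 hα0), ← div_eq_mul_inv, div_lt_iff₀ hα0]
    linarith
  refine ⟨v ^ ((α⁻¹ : ℝ) : ℂ), ?_, ?_⟩
  · rw [Complex.cpow_ofReal_re]
    exact mul_pos (Real.rpow_pos_of_pos hn _) (Real.cos_pos_of_mem_Ioo (abs_lt.1 harg'))
  · have him : (Complex.log v * (α⁻¹ : ℝ)).im = v.arg * α⁻¹ := by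
      rw [Complex.im_mul_ofReal, Complex.log_im]
    rw [← Complex.cpow_mul, ← Complex.ofReal_mul, inv_mul_cancel₀ hα0.ne', Complex.ofReal_one,
      Complex.cpow_one]
    · rw [him]; linarith [(abs_lt.1 harg').1]
    · rw [him]; linarith [(abs_lt.1 harg').2]

/-- The conformal map `(((1 + z) / (1 - z)) ^ α - 1) / (2 * α)` of the unit disk onto the interior of
the complement of a sector. -/
noncomputable def sectorMap (α : ℝ) (z : ℂ) : ℂ := (halfPlaneMap z ^ (α : ℂ) - 1) / (2 * α)

theorem one_add_sectorMap {α : ℝ} (hα : α ≠ 0) (z : ℂ) :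
    1 + 2 * α * sectorMap α z = halfPlaneMap z ^ (α : ℂ) := by
  have : (α : ℂ) ≠ 0 := by exact_mod_cast hα
  rw [sectorMap]
  field_simp
  ring

theorem hasDerivAt_sectorMap (α : ℝ) {z : ℂ} (hz : z ∈ Metric.ball (0 : ℂ) 1) :
    HasDerivAt (sectorMap α) ((α * halfPlaneMap z ^ ((α : ℂ) - 1) * (2 / (1 - z) ^ 2)) / (2 * α))
      z :=
  (((hasDerivAt_halfPlaneMap (one_sub_ne_zero_of_mem_ball hz)).cpow_const
    (Or.inl (halfPlaneMap_re_pos hz))).sub_const 1).div_const _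

theorem sectorMap_image {α : ℝ} (hα₁ : 1 ≤ α) (hα₂ : α ≤ 2) :
    sectorMap α '' Metric.ball 0 1 =
      {w : ℂ | 1 + 2 * α * w ∈ openSector (Real.pi * α / 2)} := by
  have hα0 : 0 < α := one_pos.trans_le hα₁
  ext w
  constructor
  · rintro ⟨z, hz, rfl⟩
    rw [mem_ofPred_eq, one_add_sectorMap hα0.ne']
    exact cpow_mem_openSector hα0 hα₂ (halfPlaneMap_re_pos hz)
  · intro hw
    obtain ⟨u, hu, huw⟩ := exists_cpow_eq_of_mem_openSector hα₁ hw
    obtain ⟨z, hz, rfl⟩ := exists_halfPlaneMap_eq hu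
    refine ⟨z, hz, ?_⟩
    rw [← one_add_sectorMap hα0.ne'] at huw
    have : (α : ℂ) ≠ 0 := by exact_mod_cast hα0.ne'
    simpa [this] using huw

theorem tendsto_norm_halfPlaneMap :
    Tendsto (fun z => ‖halfPlaneMap z‖) (𝓝[Metric.ball 0 1] 1) atTop := by
  have h1 : Tendsto (fun z : ℂ => ‖1 + z‖) (𝓝[Metric.ball 0 1] 1) (𝓝 2) := by
    have : Tendsto (fun z : ℂ => ‖1 + z‖) (𝓝 1) (𝓝 ‖(1 : ℂ) + 1‖) :=
      Continuous.tendsto (by fun_prop) 1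
    norm_num at this
    exact this.mono_left nhdsWithin_le_nhds
  have h2 : Tendsto (fun z : ℂ => ‖1 - z‖) (𝓝[Metric.ball 0 1] 1) (𝓝[>] 0) := by
    refine tendsto_nhdsWithin_iff.2 ⟨?_, ?_⟩
    · have : Tendsto (fun z : ℂ => ‖1 - z‖) (𝓝 1) (𝓝 ‖(1 : ℂ) - 1‖) :=
        Continuous.tendsto (by fun_prop) 1
      rw [sub_self, norm_zero] at this
      exact this.mono_left nhdsWithin_le_nhds
    · filter_upwards [self_mem_nhdsWithin] with z hz
      exact norm_pos_iff.2 (one_sub_ne_zero_of_mem_ball hz)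
  have := h1.pos_mul_atTop two_pos h2.inv_tendsto_nhdsGT_zero
  refine this.congr fun z => ?_
  rw [halfPlaneMap, norm_div, div_eq_mul_inv, Pi.inv_apply]

theorem norm_halfPlaneMap_rpow_le {α : ℝ} (hα : 0 < α) (z : ℂ) :
    ‖halfPlaneMap z‖ ^ α ≤ 2 * α * ‖sectorMap α z‖ + 1 := by
  rw [← Complex.norm_cpow_real, ← one_add_sectorMap hα.ne']
  refine (norm_add_le _ _).trans_eq ?_
  rw [norm_one, norm_mul, norm_mul, Complex.norm_real, Real.norm_of_nonneg hα.le, add_comm]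
  simp

theorem sectorMap_mem_Co {α : ℝ} (hα₁ : 1 < α) (hα₂ : α ≤ 2) : sectorMap α ∈ Co α := by
  have hα0 : 0 < α := one_pos.trans hα₁
  have hαc : (α : ℂ) ≠ 0 := by exact_mod_cast hα0.ne'
  have hpi := Real.pi_pos
  have hγ0 : 0 ≤ Real.pi * α / 2 := by positivity
  refine ⟨fun z hz => (hasDerivAt_sectorMap α hz).differentiableAt.differentiableWithinAt, ?_, ?_,
    ?_, ?_, ?_, ?_⟩
  · simp [sectorMap, halfPlaneMap]
  · rw [(hasDerivAt_sectorMap α (Metric.mem_ball_self one_pos)).deriv]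
    simp [halfPlaneMap]
    field_simp
  · rw [← tendsto_norm_atTop_iff_cobounded]
    have h1 := (tendsto_atTop_add_const_right _ (-1)
      ((tendsto_rpow_atTop hα0).comp tendsto_norm_halfPlaneMap)).atTop_div_const
      (by positivity : 0 < 2 * α)
    refine tendsto_atTop_mono (fun z => ?_) h1
    rw [div_le_iff₀ (by positivity)]
    have := norm_halfPlaneMap_rpow_le hα0 z
    simp only [Function.comp_apply]
    linarith
  · intro z hz w hw h
    refine halfPlaneMap_injOn hz hw ?_
    rw [← cpow_cpow_inv hα0 hα₂ (halfPlaneMap_re_pos hz),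
      ← cpow_cpow_inv hα0 hα₂ (halfPlaneMap_re_pos hw), ← one_add_sectorMap hα0.ne',
      ← one_add_sectorMap hα0.ne', h]
  · rw [sectorMap_image hα₁.le hα₂]
    intro x hx y hy a b ha hb hab
    have := convex_compl_openSector (γ := Real.pi * α / 2)
      (Real.cos_nonpos_of_pi_div_two_le_of_le (by nlinarith) (by nlinarith)) hx hy ha hb hab
    simp only [mem_compl_iff, mem_ofPred_eq] at this ⊢
    convert this using 2
    have habc : (a : ℂ) + b = 1 := by exact_mod_cast hab
    simp only [Complex.real_smul]
    linear_combination -habc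
  · rw [sectorMap_image hα₁.le hα₂]
    have hsub : {θ : ℝ | θ ∈ Ioc (-Real.pi) Real.pi ∧ ∀ w : ℂ, ∀ᶠ t : ℝ in atTop,
        w + (t : ℂ) * Complex.exp ((θ : ℂ) * Complex.I) ∈
          {w : ℂ | 1 + 2 * α * w ∈ openSector (Real.pi * α / 2)}} ⊆
        Ioo (-(Real.pi * α / 2)) (Real.pi * α / 2) := by
      rintro θ ⟨hθ, h⟩
      -- It suffices to test rays from the vertex `-1 / (2α)` of the image.
      obtain ⟨t, ht, ht0⟩ := ((h (-1 / (2 * α))).and (eventually_gt_atTop 0)).exists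
      have heq : 1 + 2 * (α : ℂ) * (-1 / (2 * α) + t * Complex.exp (θ * Complex.I)) =
          ((2 * α * t : ℝ) : ℂ) * Complex.exp (θ * Complex.I) := by
        push_cast
        field_simp
        ring
      have hpos : 0 < 2 * α * t := by positivity
      rw [mem_ofPred_eq, heq, openSector, mem_ofPred_eq, norm_mul, Complex.norm_exp_ofReal_mul_I,
        mul_one, Complex.norm_real, Real.norm_of_nonneg hpos.le, Complex.re_ofReal_mul,
        Complex.exp_ofReal_mul_I_re, mul_lt_mul_iff_right₀ hpos] at ht
      exact abs_lt.1 (abs_lt_of_cos_lt_cos hγ0 (abs_le.2 ⟨hθ.1.le, hθ.2⟩) ht)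
    refine (measureReal_mono hsub (by simp)).trans_eq ?_
    rw [Real.volume_real_Ioo_of_le (by linarith)]
    ring

/-! ### Logarithmic growth of the circle means. -/

/-- On `|z| = 1 - ε` one has `|1 - z| ≤ ε + (1 - ε) θ ≤ 2θ` as soon as `θ ≥ ε`, while `|1 + z| ≥ Re
(1 + z) ≥ 1`. -/
theorem inv_two_mul_le_norm_halfPlaneMap {ε θ : ℝ} (hε0 : 0 < ε) (hε : ε ≤ θ) (hθ : θ ≤ 1) :
    1 / (2 * θ) ≤ ‖halfPlaneMap (circleMap 0 (1 - ε) θ)‖ := by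
  have hθ0 : 0 < θ := hε0.trans_le hε
  have hz : circleMap 0 (1 - ε) θ = (1 - ε : ℝ) * Complex.exp (θ * Complex.I) := by
    simp [circleMap]
  have h1 : 1 ≤ ‖1 + circleMap 0 (1 - ε) θ‖ := by
    refine le_trans ?_ (Complex.re_le_norm _)
    rw [hz, Complex.add_re, Complex.one_re, Complex.re_ofReal_mul, Complex.exp_ofReal_mul_I_re]
    have := Real.cos_nonneg_of_neg_pi_div_two_le_of_le (x := θ) (by linarith [Real.pi_gt_three])
      (by linarith [Real.pi_gt_three])
    nlinarith
  have h2 : ‖1 - circleMap 0 (1 - ε) θ‖ ≤ 2 * θ := by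
    have heq : 1 - circleMap 0 (1 - ε) θ =
        (ε : ℂ) - (1 - ε : ℝ) * (Complex.exp (Complex.I * θ) - 1) := by
      rw [hz, mul_comm Complex.I]
      push_cast
      ring
    rw [heq]
    refine (norm_sub_le _ _).trans ?_
    rw [norm_mul, Complex.norm_real, Complex.norm_real, Real.norm_of_nonneg hε0.le,
      Real.norm_of_nonneg (by linarith)]
    have := Real.norm_exp_I_mul_ofReal_sub_one_le (x := θ)
    rw [Real.norm_of_nonneg hθ0.le] at this
    nlinarith [norm_nonneg (Complex.exp (Complex.I * θ) - 1)]
  have h3 : 0 < ‖1 - circleMap 0 (1 - ε) θ‖ := by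
    refine norm_pos_iff.2 (one_sub_ne_zero_of_mem_ball ?_)
    rw [mem_ball_zero_iff, norm_circleMap_zero, abs_of_nonneg (by linarith)]
    linarith
  rw [halfPlaneMap, norm_div]
  exact div_le_div₀ (norm_nonneg _) h1 h3 h2

theorem continuousOn_halfPlaneMap : ContinuousOn halfPlaneMap (Metric.ball 0 1) := fun _ hz =>
  (hasDerivAt_halfPlaneMap (one_sub_ne_zero_of_mem_ball hz)).continuousAt.continuousWithinAt

theorem circleIntegrable_norm_halfPlaneMap {r : ℝ} (hr0 : 0 ≤ r) (hr1 : r < 1) :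
    CircleIntegrable (fun z => ‖halfPlaneMap z‖) 0 r := by
  simpa using continuousOn_halfPlaneMap.circleIntegrable_norm_rpow zero_le_one hr0 hr1

theorem log_le_circleAverage_norm_halfPlaneMap {ε : ℝ} (hε0 : 0 < ε) (hε1 : ε ≤ 1) :
    (4 * Real.pi)⁻¹ * Real.log (1 / ε) ≤
      Real.circleAverage (fun z => ‖halfPlaneMap z‖) 0 (1 - ε) := by
  have hint := circleIntegrable_norm_halfPlaneMap (sub_nonneg.2 hε1) (sub_lt_self 1 hε0)
  have hpi := Real.pi_gt_three
  have h1 : ∫ θ in ε..1, ‖halfPlaneMap (circleMap 0 (1 - ε) θ)‖ ≤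
      ∫ θ in 0..2 * Real.pi, ‖halfPlaneMap (circleMap 0 (1 - ε) θ)‖ :=
    intervalIntegral.integral_mono_interval hε0.le hε1 (by linarith)
      (Eventually.of_forall fun _ => norm_nonneg _) hint
  have h2 : ∫ θ in ε..1, 1 / 2 * (1 / θ) ≤
      ∫ θ in ε..1, ‖halfPlaneMap (circleMap 0 (1 - ε) θ)‖ := by
    refine intervalIntegral.integral_mono_on hε1 ?_ (hint.mono_set ?_) fun θ hθ => ?_
    · refine (intervalIntegral.intervalIntegrable_one_div (fun θ hθ => ?_)
        continuousOn_id).const_mul _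
      rw [uIcc_of_le hε1] at hθ
      exact (hε0.trans_le hθ.1).ne'
    · rw [uIcc_of_le hε1, uIcc_of_le (by linarith)]
      exact Icc_subset_Icc hε0.le (by linarith)
    · rw [one_div_mul_one_div]
      exact inv_two_mul_le_norm_halfPlaneMap hε0 hθ.1 hθ.2
  rw [intervalIntegral.integral_const_mul, integral_one_div_of_pos hε0 one_pos] at h2
  have h3 : (4 * Real.pi)⁻¹ = (2 * Real.pi)⁻¹ * (1 / 2) := by
    field_simp
    norm_num
  rw [Real.circleAverage_def, smul_eq_mul, h3, mul_assoc]
  exact mul_le_mul_of_nonneg_left (h2.trans h1) (by positivity)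

/-- Since `1/α ≤ p`, `|h|` is at most a constant times `|sectorMap|^p` plus a constant, so bounded
`p`-means would bound the means of `|h|`. -/
theorem sectorMap_not_mem_hardySpace {α p : ℝ} (hα : 0 < α) (hp : 1 / α ≤ p) :
    sectorMap α ∉ HardySpace p := by
  rintro ⟨hd, C, hC⟩
  have hp0 : 0 < p := (by positivity : 0 < 1 / α).trans_le hp
  have hle : ∀ z, ‖halfPlaneMap z‖ ≤ 2 ^ p * ((2 * α) ^ p * ‖sectorMap α z‖ ^ p + 1) := by
    intro z
    set y : ℝ := 2 * α * ‖sectorMap α z‖ with hy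
    have hy0 : 0 ≤ y := by positivity
    calc ‖halfPlaneMap z‖ = (‖halfPlaneMap z‖ ^ α) ^ (1 / α) := by
          rw [← Real.rpow_mul (norm_nonneg _), mul_one_div_cancel hα.ne', Real.rpow_one]
      _ ≤ (y + 1) ^ (1 / α) := Real.rpow_le_rpow (by positivity)
          (norm_halfPlaneMap_rpow_le hα z) (by positivity)
      -- Adding 1 makes the base at least 1, so the exponent may be raised from `1/α` to `p`.
      _ ≤ (y + 1) ^ p := Real.rpow_le_rpow_of_exponent_le (by linarith) hp
      _ ≤ (2 * max y 1) ^ p := Real.rpow_le_rpow (by positivity)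
          (by linarith [le_max_left y 1, le_max_right y 1]) hp0.le
      _ = 2 ^ p * max y 1 ^ p := Real.mul_rpow two_pos.le (by positivity)
      _ ≤ 2 ^ p * (y ^ p + 1) := by
          refine mul_le_mul_of_nonneg_left ?_ (by positivity)
          rcases le_total y 1 with h | h
          · rw [max_eq_right h, Real.one_rpow]
            linarith [Real.rpow_nonneg hy0 p]
          · rw [max_eq_left h]
            linarith
      _ = _ := by rw [hy, Real.mul_rpow (by positivity) (norm_nonneg _)]
  set M : ℝ := 2 ^ p * ((2 * α) ^ p * C + 1) with hM
  have hbound : ∀ r : ℝ, 0 ≤ r → r < 1 →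
      Real.circleAverage (fun z => ‖halfPlaneMap z‖) 0 r ≤ M := by
    intro r hr0 hr1
    have hi := hd.continuousOn.circleIntegrable_norm_rpow hp0.le hr0 hr1
    have hi1 : CircleIntegrable (fun z => (2 * α) ^ p * ‖sectorMap α z‖ ^ p) 0 r :=
      hi.const_fun_smul (a := (2 * α) ^ p)
    have hc : CircleIntegrable (fun _ : ℂ => (1 : ℝ)) 0 r := circleIntegrable_const _ _ _
    refine (Real.circleAverage_mono (circleIntegrable_norm_halfPlaneMap hr0 hr1)
      ((hi1.add hc).const_smul (a := (2 : ℝ) ^ p)) fun z _ => hle z).trans ?_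
    rw [Real.circleAverage_smul, Real.circleAverage_add hi1 hc, Real.circleAverage_const]
    have := Real.circleAverage_fun_smul (a := (2 * α) ^ p) (f := fun z => ‖sectorMap α z‖ ^ p)
      (c := 0) (R := r)
    simp only [smul_eq_mul] at this ⊢
    rw [this, hM]
    gcongr
    exact hC r hr0 hr1
  -- At radius `1 - exp (-N)` the logarithmic lower bound is `N / (4π)`, which exceeds `M`.
  set N : ℝ := 4 * Real.pi * |M| + 1 with hN
  have hpi := Real.pi_pos
  have hN0 : 0 < N := by positivity
  have h1 := log_le_circleAverage_norm_halfPlaneMap (Real.exp_pos (-N))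
    (Real.exp_le_one_iff.2 (by linarith))
  have h2 := h1.trans (hbound _ (sub_nonneg.2 (Real.exp_le_one_iff.2 (by linarith)))
    (sub_lt_self 1 (Real.exp_pos _)))
  rw [one_div, ← Real.exp_neg, Real.log_exp, neg_neg, inv_mul_le_iff₀ (by positivity), hN] at h2
  nlinarith [le_abs_self M]

theorem mainTheorem5 (α : ℝ) (hα₁ : 1 < α) (hα₂ : α ≤ 2) :
    (∀ p : ℝ, 0 < p → p < 1 / α → Co α ⊆ HardySpace p) ∧
      (∀ p : ℝ, 1 / α ≤ p → ¬ Co α ⊆ HardySpace p) :=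
  ⟨fun _ hp0 hp => Co_subset_hardySpace hα₁ hp0 hp, fun _ hp h =>
    sectorMap_not_mem_hardySpace (one_pos.trans hα₁) hp (h (sectorMap_mem_Co hα₁ hα₂))⟩
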